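/- **Proposition 2.4.** Let $X$ be a real random variable with mean $0$, variance $1$ and density $p$. The Fisher information of a density $p$ is $$I(X)=I(p)=\int_{\{p>0\}}\frac{p'(x)^2}{p(x)}\,dx$$ if $p$ is absolutely continuous (on every compact interval), where $p'$ is the Radon–Nikodym derivative of $p$, and $I(p)=+\infty$ otherwise. Let $Z$ be a standard normal random variable, with density $\varphi(x)=\frac1{\sqrt{2\pi}}e^{-x^2/2}$, and put $I(X||Z)=I(X)-I(Z)$. If $I(X)<\infty$, then $$\|p-\varphi\|_{\mathrm{TV}}\le 4\sqrt{I(X||Z)},$$ where $\|u\|_{\mathrm{TV}}=\sup\sum_{k=1}^n|u(x_k)-u(x_{k-1})|$, the supremum running over all finite collections $x_0<x_1<\dots<x_n$ of real numbers, is the total variation of the function $u$. -/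

import Mathlib

open MeasureTheory ProbabilityTheory Set
open scoped ENNReal

noncomputable section

/-- The real random variable `X` on `(Ω, P)` has the (nonnegative, everywhere defined) density `p`
with respect to Lebesgue measure. -/
def HasRealDensity {Ω : Type*} [MeasurableSpace Ω] (P : Measure Ω) (X : Ω → ℝ) (p : ℝ → ℝ) : Prop :=
  Measurable X ∧ (∀ x, 0 ≤ p x) ∧
    P.map X = (volume : Measure ℝ).withDensity (fun x => ENNReal.ofReal (p x))

/-- Absolute continuity of a function on the real line: absolute continuity, in the usual
`ε`-`δ` sense, on every compact interval. -/
def IsAbsCont (p : ℝ → ℝ) : Prop :=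
  ∀ a b : ℝ, AbsolutelyContinuousOnInterval p a b

open Classical in
/-- The Fisher information `I(p) = ∫ p'(x)² / p(x) dx` of a density `p`, the integral being
extended over `{p > 0}`; it is `+∞` if `p` is not absolutely continuous. An absolutely continuous
`p` is differentiable almost everywhere and `deriv p` is then its Radon-Nikodym derivative. -/
def fisherInfo (p : ℝ → ℝ) : ℝ≥0∞ :=
  if IsAbsCont p then ∫⁻ x in {x | 0 < p x}, ENNReal.ofReal ((deriv p x) ^ 2 / p x) else ∞

/-- The density of the standard normal distribution `N(0, 1)`. -/
def stdNormalDensity : ℝ → ℝ := gaussianPDFReal 0 1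

/-- The relative Fisher information `I(X||Z) = I(X) - I(Z)` of a random variable `X` with density
`p` and finite Fisher information, with mean zero and variance one, with respect to a standard
normal random variable `Z`. -/
def relFisherInfo (p : ℝ → ℝ) : ℝ :=
  (fisherInfo p).toReal - (fisherInfo stdNormalDensity).toReal

/-- The total variation norm of a function `u` on the real line, in the sense of the theory of
functions: the supremum of the sums `∑ |u (x (k + 1)) - u (x k)|` over all finite increasing
collections of points. -/
def tvNorm (u : ℝ → ℝ) : ℝ≥0∞ := eVariationOn u univ

end

/-! Put `u = p - φ` and `r = u' + x u`. Since `φ' + x φ = 0`, also `r = p' + x p` almost everywhere.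
Expanding the square and using `∫ x p' = -1` and `∫ x² p = 1` gives `∫ r² / p = I(p) - 1 = I(X||Z)`,
so `R = ∫ |r| ≤ √I(X||Z)` by Cauchy–Schwarz (`HasRealDensity.integral_abs_deriv_add_le`). It remains
to bound the variation `∫ |u'|` by `4 R`. The integrating factor yields `u(x) = u(0) e^{-x²/2} +
∫_0^x e^{(t²-x²)/2} r(t) dt`. Tonelli's theorem bounds the last term in `L¹`, with weight `1` or
`|x|` (`lintegral_gaussianKernel_le`). Weight `1` and `∫ u = 0` give `|u(0)| ≤ R`; weight `|x|`
gives `∫ |x u| ≤ 2 |u(0)| + R ≤ 3 R`. Finally `|u'| ≤ |r| + |x u|`. -/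

/-- A function whose increments are controlled by the integral of `g` has variation at most
`∫⁻ g`. -/
theorem eVariationOn_univ_le_lintegral {f : ℝ → ℝ} {g : ℝ → ℝ≥0∞}
    (h : ∀ a b, a ≤ b → edist (f b) (f a) ≤ ∫⁻ x in Ioc a b, g x) :
    eVariationOn f univ ≤ ∫⁻ x, g x := by
  refine iSup_le fun ⟨n, u, hu, _⟩ => ?_
  calc ∑ i ∈ Finset.range n, edist (f (u (i + 1))) (f (u i))
      ≤ ∑ i ∈ Finset.range n, ∫⁻ x in Ioc (u i) (u (i + 1)), g x :=
        Finset.sum_le_sum fun i _ => h _ _ (hu (Nat.le_succ i))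
    _ = ∫⁻ x in ⋃ i ∈ Finset.range n, Ioc (u i) (u (i + 1)), g x := by
        exact (lintegral_biUnion_finset
          (fun i _ j _ hij => hu.pairwise_disjoint_on_Ioc_succ hij)
          (fun i _ => measurableSet_Ioc) _).symm
    _ ≤ ∫⁻ x, g x := setLIntegral_le_lintegral _ _

theorem IsAbsCont.continuous {f : ℝ → ℝ} (hf : IsAbsCont f) : Continuous f := by
  refine continuous_iff_continuousAt.2 fun x => ?_
  refine (hf (x - 1) (x + 1)).continuousOn.continuousAt ?_
  rw [uIcc_of_le (by linarith)]
  exact Icc_mem_nhds (by linarith) (by linarith)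

theorem IsAbsCont.ae_differentiableAt {f : ℝ → ℝ} (hf : IsAbsCont f) :
    ∀ᵐ x, DifferentiableAt ℝ f x := by
  have h : ∀ᵐ x, ∀ n : ℕ, x ∈ uIcc (-n : ℝ) n → DifferentiableAt ℝ f x :=
    ae_all_iff.2 fun n => (hf (-n) n).ae_differentiableAt
  filter_upwards [h] with x hx
  obtain ⟨n, hn⟩ := exists_nat_ge |x|
  refine hx n ?_
  rw [uIcc_of_le (by linarith [abs_nonneg x])]
  exact abs_le.1 hn

theorem ContDiff.isAbsCont {f : ℝ → ℝ} (hf : ContDiff ℝ 1 f) : IsAbsCont f :=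
  fun _ _ => hf.contDiffOn.absolutelyContinuousOnInterval

theorem IsAbsCont.eVariationOn_le {f : ℝ → ℝ} (hf : IsAbsCont f) :
    eVariationOn f univ ≤ ∫⁻ x, ‖deriv f x‖ₑ := by
  refine eVariationOn_univ_le_lintegral fun a b hab => ?_
  rw [edist_eq_enorm_sub, ← (hf a b).integral_deriv_eq_sub, intervalIntegral.integral_of_le hab]
  exact enorm_integral_le_lintegral_enorm _

/-! ### Integrating factor and Gaussian kernel bounds -/

/-- The weight `exp (x ^ 2 / 2)` turns `u' + x u` into a derivative. -/
theorem IsAbsCont.integral_exp_mul {u : ℝ → ℝ} (hu : IsAbsCont u) (x : ℝ) :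
    ∫ t in (0 : ℝ)..x, Real.exp ((t ^ 2 - x ^ 2) / 2) * (deriv u t + t * u t) =
      u x - u 0 * Real.exp (-x ^ 2 / 2) := by
  have he : ContDiff ℝ 1 fun t : ℝ => Real.exp ((t ^ 2 - x ^ 2) / 2) := by fun_prop
  have hd : ∀ t, deriv (fun t : ℝ => Real.exp ((t ^ 2 - x ^ 2) / 2)) t =
      Real.exp ((t ^ 2 - x ^ 2) / 2) * t := fun t => by
    have : HasDerivAt (fun t : ℝ => (t ^ 2 - x ^ 2) / 2) t t := by
      have := (((hasDerivAt_id t).pow 2).sub_const (x ^ 2)).div_const 2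
      simpa using this
    exact this.exp.deriv
  have := (hu 0 x).integral_deriv_mul_eq_sub (he.isAbsCont 0 x)
  simp only [hd, sub_self, zero_div, Real.exp_zero, mul_one] at this
  rw [show -x ^ 2 / 2 = (0 ^ 2 - x ^ 2) / 2 by ring, ← this]
  refine intervalIntegral.integral_congr fun t _ => ?_
  ring

theorem IsAbsCont.enorm_sub_exp_le {u : ℝ → ℝ} (hu : IsAbsCont u) (x : ℝ) :
    ‖u x - u 0 * Real.exp (-x ^ 2 / 2)‖ₑ ≤
      ∫⁻ t in uIoc 0 x, ‖Real.exp ((t ^ 2 - x ^ 2) / 2)‖ₑ * ‖deriv u t + t * u t‖ₑ := by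
  rw [← hu.integral_exp_mul, ← ofReal_norm, intervalIntegral.norm_intervalIntegral_eq, ofReal_norm]
  simpa only [enorm_mul] using enorm_integral_le_lintegral_enorm
    (μ := volume.restrict (uIoc 0 x))
    fun t => Real.exp ((t ^ 2 - x ^ 2) / 2) * (deriv u t + t * u t)

theorem measurableSet_mem_uIoc_zero : MeasurableSet {z : ℝ × ℝ | z.2 ∈ uIoc 0 z.1} := by
  have : {z : ℝ × ℝ | z.2 ∈ uIoc 0 z.1} = {z | min 0 z.1 < z.2} ∩ {z | z.2 ≤ max 0 z.1} := rfl
  rw [this]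
  exact (measurableSet_lt (by fun_prop) (by fun_prop)).inter
    (measurableSet_le (by fun_prop) (by fun_prop))

/-- For even `F`, the integral over the points `x` with `t` between `0` and `x`. -/
theorem lintegral_mem_uIoc_le {F : ℝ → ℝ≥0∞} (hF : ∀ x, F (-x) = F x) (t : ℝ) :
    ∫⁻ x in {x | t ∈ uIoc 0 x}, F x ≤ ∫⁻ x in Ioi |t|, F x := by
  rcases le_or_gt t 0 with ht | ht
  · have hs : {x | t ∈ uIoc 0 x} ⊆ Neg.neg ⁻¹' Ioi |t| := fun x hx => by
      rw [abs_of_nonpos ht]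
      simp only [mem_ofPred_eq, uIoc, mem_Ioc, inf_lt_iff] at hx
      simp only [mem_preimage, mem_Ioi]
      rcases hx.1 with h | h <;> linarith
    calc ∫⁻ x in {x | t ∈ uIoc 0 x}, F x ≤ ∫⁻ x in Neg.neg ⁻¹' Ioi |t|, F x :=
          lintegral_mono_set hs
      _ = ∫⁻ x in Neg.neg ⁻¹' Ioi |t|, F (-x) := by simp only [hF]
      _ = ∫⁻ x in Ioi |t|, F x :=
          (Measure.measurePreserving_neg volume).setLIntegral_comp_preimage_emb
            (MeasurableEquiv.neg ℝ).measurableEmbedding _ _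
  · rw [abs_of_pos ht, setLIntegral_congr Ioi_ae_eq_Ici]
    refine lintegral_mono_set fun x hx => ?_
    simp only [mem_ofPred_eq, uIoc, mem_Ioc, le_sup_iff] at hx
    simp only [mem_Ici]
    rcases hx.2 with h | h <;> linarith

/-- The integrand is the derivative of `-exp ((s² - x²) / 2)`. That the value does not depend on `s`
is what makes the kernel bound with weight `|x|` uniform. -/
theorem lintegral_Ioi_mul_exp (s : ℝ) (hs : 0 ≤ s) :
    ∫⁻ x in Ioi s, ‖x‖ₑ * ‖Real.exp ((s ^ 2 - x ^ 2) / 2)‖ₑ = 1 := by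
  have hd : ∀ x ∈ Ici s, HasDerivAt (fun x : ℝ => -Real.exp ((s ^ 2 - x ^ 2) / 2))
      (x * Real.exp ((s ^ 2 - x ^ 2) / 2)) x := fun x _ => by
    have : HasDerivAt (fun x : ℝ => (s ^ 2 - x ^ 2) / 2) (-x) x := by
      have := (((hasDerivAt_id x).pow 2).const_sub (s ^ 2)).div_const 2
      convert! this using 1
      simp
      ring
    convert! this.exp.neg using 1
    ring
  have hn : ∀ x ∈ Ioi s, 0 ≤ x * Real.exp ((s ^ 2 - x ^ 2) / 2) := fun x hx =>
    mul_nonneg (hs.trans (le_of_lt hx)) (Real.exp_pos _).le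
  have hl : Filter.Tendsto (fun x : ℝ => -Real.exp ((s ^ 2 - x ^ 2) / 2)) Filter.atTop (nhds 0) := by
    rw [← neg_zero]
    refine (Real.tendsto_exp_atBot.comp ?_).neg
    refine Filter.Tendsto.atBot_div_const two_pos ?_
    exact Filter.tendsto_atBot_add_const_left _ _
      (Filter.tendsto_neg_atTop_atBot.comp (Filter.tendsto_pow_atTop two_ne_zero))
  have hi := integrableOn_Ioi_deriv_of_nonneg' hd hn hl
  have hv := integral_Ioi_of_hasDerivAt_of_nonneg' hd hn hl
  rw [sub_self, zero_div, Real.exp_zero, sub_neg_eq_add, zero_add] at hv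
  have := ofReal_integral_eq_lintegral_ofReal hi
    ((ae_restrict_iff' measurableSet_Ioi).2 (Filter.Eventually.of_forall hn))
  rw [hv, ENNReal.ofReal_one] at this
  rw [this]
  refine setLIntegral_congr_fun measurableSet_Ioi fun x hx => ?_
  rw [← enorm_mul, ← ofReal_norm, Real.norm_of_nonneg (hn x hx)]

/-- For `x > s ≥ 0` one has `s² - x² ≤ -(x - s)²`; then translate by `s`. The bound is the full
Gaussian integral so that it cancels in `IsAbsCont.enorm_zero_le`. -/
theorem lintegral_Ioi_exp_le (s : ℝ) (hs : 0 ≤ s) :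
    ∫⁻ x in Ioi s, ‖Real.exp ((s ^ 2 - x ^ 2) / 2)‖ₑ ≤ ∫⁻ x, ‖Real.exp (-x ^ 2 / 2)‖ₑ := by
  rw [← lintegral_sub_right_eq_self (fun x : ℝ => ‖Real.exp (-x ^ 2 / 2)‖ₑ) s]
  refine le_trans (setLIntegral_mono' measurableSet_Ioi fun x hx => ?_)
    (setLIntegral_le_lintegral (Ioi s) _)
  rw [Real.enorm_eq_ofReal (Real.exp_pos _).le, Real.enorm_eq_ofReal (Real.exp_pos _).le]
  refine ENNReal.ofReal_le_ofReal (Real.exp_le_exp.2 ?_)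
  have : s < x := hx
  nlinarith [mul_nonneg hs (sub_nonneg.2 this.le)]

/-- Tonelli's theorem for the Gaussian kernel `exp ((t ^ 2 - x ^ 2) / 2)` on the set where `t` lies
between `0` and `x`. -/
theorem lintegral_gaussianKernel_le {w g : ℝ → ℝ≥0∞} (hw : Measurable w) (hg : Measurable g)
    (hew : ∀ x, w (-x) = w x) {C : ℝ≥0∞}
    (hC : ∀ s : ℝ, 0 ≤ s → ∫⁻ x in Ioi s, w x * ‖Real.exp ((s ^ 2 - x ^ 2) / 2)‖ₑ ≤ C) :
    ∫⁻ x, w x * ∫⁻ t in uIoc 0 x, ‖Real.exp ((t ^ 2 - x ^ 2) / 2)‖ₑ * g t ≤ C * ∫⁻ t, g t := by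
  let K : ℝ → ℝ → ℝ≥0∞ := fun x t => {z : ℝ × ℝ | z.2 ∈ uIoc 0 z.1}.indicator
    (fun z => w z.1 * ‖Real.exp ((z.2 ^ 2 - z.1 ^ 2) / 2)‖ₑ * g z.2) (x, t)
  have hK : Measurable (Function.uncurry K) := by
    refine Measurable.indicator ?_ measurableSet_mem_uIoc_zero
    fun_prop
  calc ∫⁻ x, w x * ∫⁻ t in uIoc 0 x, ‖Real.exp ((t ^ 2 - x ^ 2) / 2)‖ₑ * g t
      = ∫⁻ x, ∫⁻ t, K x t := by
        refine lintegral_congr fun x => ?_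
        rw [← lintegral_const_mul _ (by fun_prop), ← lintegral_indicator measurableSet_uIoc]
        refine lintegral_congr fun t => ?_
        by_cases ht : t ∈ uIoc 0 x <;> simp [K, indicator, ht, mul_assoc]
    _ = ∫⁻ t, ∫⁻ x, K x t := lintegral_lintegral_swap hK.aemeasurable
    _ ≤ ∫⁻ t, C * g t := by
        refine lintegral_mono fun t => ?_
        have hm : MeasurableSet {x : ℝ | t ∈ uIoc 0 x} :=
          measurableSet_mem_uIoc_zero.preimage (measurable_id.prodMk measurable_const)
        calc ∫⁻ x, K x t
            = ∫⁻ x in {x | t ∈ uIoc 0 x}, w x * ‖Real.exp ((t ^ 2 - x ^ 2) / 2)‖ₑ * g t := by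
              rw [← lintegral_indicator hm]
              rfl
          _ = (∫⁻ x in {x | t ∈ uIoc 0 x}, w x * ‖Real.exp ((t ^ 2 - x ^ 2) / 2)‖ₑ) * g t :=
              lintegral_mul_const _ (by fun_prop)
          _ ≤ C * g t := by
              gcongr
              refine (lintegral_mem_uIoc_le (fun x => by rw [hew, neg_sq]) t).trans ?_
              simpa only [sq_abs] using hC |t| (abs_nonneg t)
    _ = C * ∫⁻ t, g t := lintegral_const_mul _ hg

theorem lintegral_abs_mul_exp_le : ∫⁻ x : ℝ, ‖x‖ₑ * ‖Real.exp (-x ^ 2 / 2)‖ₑ ≤ 2 := by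
  have h0 := lintegral_Ioi_mul_exp 0 le_rfl
  simp only [ne_eq, OfNat.ofNat_ne_zero, not_false_eq_true, zero_pow, zero_sub] at h0
  -- At `t = 0` the set is the negative half-line, because `uIoc` omits its left endpoint.
  have h1 := lintegral_mem_uIoc_le (F := fun x : ℝ => ‖x‖ₑ * ‖Real.exp (-x ^ 2 / 2)‖ₑ)
    (fun x => by rw [enorm_neg, neg_sq]) 0
  rw [abs_zero, h0] at h1
  have hs : {x : ℝ | (0 : ℝ) ∈ uIoc 0 x} = Iio 0 := by
    ext x
    simp [uIoc]
  rw [hs, setLIntegral_congr Iio_ae_eq_Iic] at h1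
  rw [← lintegral_add_compl _ measurableSet_Iic, compl_Iic, h0]
  exact (add_le_add_left h1 1).trans (by norm_num)

theorem integrable_exp_neg_sq_div_two : Integrable fun x : ℝ => Real.exp (-x ^ 2 / 2) := by
  refine (integrable_exp_neg_mul_sq (b := 1 / 2) (by norm_num)).congr
    (Filter.Eventually.of_forall fun x => ?_)
  simp only
  congr 1
  ring

/-! ### Stein-type estimates for `u' + x u` -/

/-- The value at `0` of a function of vanishing integral is controlled by `∫ |u' + x u|`. -/
theorem IsAbsCont.enorm_zero_le {u : ℝ → ℝ} (hu : IsAbsCont u) (hi : Integrable u)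
    (h0 : ∫ x, u x = 0) : ‖u 0‖ₑ ≤ ∫⁻ t, ‖deriv u t + t * u t‖ₑ := by
  have hg : Measurable fun t => ‖deriv u t + t * u t‖ₑ :=
    ((measurable_deriv u).add (measurable_id.mul hu.continuous.measurable)).enorm
  set N : ℝ≥0∞ := ∫⁻ x, ‖Real.exp (-x ^ 2 / 2)‖ₑ with hN
  have hpos : 0 < ∫ x : ℝ, Real.exp (-x ^ 2 / 2) := integral_exp_pos integrable_exp_neg_sq_div_two
  have hNe : N = ‖∫ x : ℝ, Real.exp (-x ^ 2 / 2)‖ₑ := by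
    rw [Real.enorm_eq_ofReal hpos.le, ofReal_integral_eq_lintegral_ofReal
      integrable_exp_neg_sq_div_two (Filter.Eventually.of_forall fun x => (Real.exp_pos _).le)]
    exact lintegral_congr fun x => Real.enorm_eq_ofReal (Real.exp_pos _).le
  have hk : ∫⁻ x, ‖u x - u 0 * Real.exp (-x ^ 2 / 2)‖ₑ ≤ N * ∫⁻ t, ‖deriv u t + t * u t‖ₑ := by
    refine (lintegral_mono hu.enorm_sub_exp_le).trans ?_
    simpa only [one_mul] using lintegral_gaussianKernel_le (w := fun _ => 1) (C := N)
      measurable_const hg (fun _ => rfl)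
      (fun s hs => by simpa only [one_mul] using lintegral_Ioi_exp_le s hs)
  -- As `∫ u = 0`, the function on the right has integral `-u(0) N`.
  have hl : N * ‖u 0‖ₑ ≤ ∫⁻ x, ‖u x - u 0 * Real.exp (-x ^ 2 / 2)‖ₑ := by
    refine le_trans (le_of_eq ?_) (enorm_integral_le_lintegral_enorm _)
    rw [integral_sub hi (integrable_exp_neg_sq_div_two.const_mul _), h0, integral_const_mul,
      zero_sub, enorm_neg, enorm_mul, hNe, mul_comm]
  refine (ENNReal.mul_le_mul_iff_right ?_ ?_).1 (hl.trans hk)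
  · rw [hNe]
    simpa using hpos.ne'
  · rw [hNe]
    exact enorm_ne_top

theorem IsAbsCont.lintegral_mul_le {u : ℝ → ℝ} (hu : IsAbsCont u) :
    ∫⁻ x, ‖x * u x‖ₑ ≤ 2 * ‖u 0‖ₑ + ∫⁻ t, ‖deriv u t + t * u t‖ₑ := by
  have hg : Measurable fun t => ‖deriv u t + t * u t‖ₑ :=
    ((measurable_deriv u).add (measurable_id.mul hu.continuous.measurable)).enorm
  have hm : Measurable u := hu.continuous.measurable
  calc ∫⁻ x, ‖x * u x‖ₑ
      ≤ ∫⁻ x, (‖x‖ₑ * ‖Real.exp (-x ^ 2 / 2)‖ₑ * ‖u 0‖ₑ +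
          ‖x‖ₑ * ‖u x - u 0 * Real.exp (-x ^ 2 / 2)‖ₑ) := by
        refine lintegral_mono fun x => ?_
        rw [enorm_mul, mul_assoc, ← mul_add, mul_comm ‖Real.exp _‖ₑ, ← enorm_mul (u 0)]
        gcongr
        exact (congrArg enorm (by ring)).trans_le
          (enorm_add_le (u 0 * Real.exp (-x ^ 2 / 2)) (u x - u 0 * Real.exp (-x ^ 2 / 2)))
    _ = (∫⁻ x : ℝ, ‖x‖ₑ * ‖Real.exp (-x ^ 2 / 2)‖ₑ) * ‖u 0‖ₑ +
          ∫⁻ x, ‖x‖ₑ * ‖u x - u 0 * Real.exp (-x ^ 2 / 2)‖ₑ := by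
        rw [lintegral_add_left (by fun_prop), lintegral_mul_const _ (by fun_prop)]
    _ ≤ 2 * ‖u 0‖ₑ + ∫⁻ t, ‖deriv u t + t * u t‖ₑ := by
        refine add_le_add (mul_le_mul_left lintegral_abs_mul_exp_le _) ?_
        · refine (lintegral_mono fun x => mul_le_mul_right (hu.enorm_sub_exp_le x) _).trans ?_
          simpa only [one_mul] using lintegral_gaussianKernel_le (w := fun x => ‖x‖ₑ) (C := 1)
            measurable_enorm hg enorm_neg (fun s hs => (lintegral_Ioi_mul_exp s hs).le)

/-- Stein-type estimate: the total variation of an integrable absolutely continuous function with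
vanishing integral is at most `4 ∫ |u' + x u|`. -/
theorem IsAbsCont.eVariationOn_le_four_mul {u : ℝ → ℝ} (hu : IsAbsCont u) (hi : Integrable u)
    (h0 : ∫ x, u x = 0) : eVariationOn u univ ≤ 4 * ∫⁻ t, ‖deriv u t + t * u t‖ₑ := by
  have hm : Measurable u := hu.continuous.measurable
  set R := ∫⁻ t, ‖deriv u t + t * u t‖ₑ with hR
  calc eVariationOn u univ ≤ ∫⁻ x, ‖deriv u x‖ₑ := hu.eVariationOn_le
    _ ≤ ∫⁻ x, (‖deriv u x + x * u x‖ₑ + ‖x * u x‖ₑ) := lintegral_mono fun x => by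
        simpa using enorm_sub_le (E := ℝ) (a := deriv u x + x * u x) (b := x * u x)
    _ = R + ∫⁻ x, ‖x * u x‖ₑ := lintegral_add_right _ (by fun_prop)
    _ ≤ R + (2 * R + R) := by
        gcongr
        refine hu.lintegral_mul_le.trans ?_
        gcongr
        exact hu.enorm_zero_le hi h0
    _ = 4 * R := by ring

/-- An integrable derivative gives `f` limits at `±∞`, and integrability of `f` forces both to
vanish. -/
theorem IsAbsCont.integral_deriv_eq_zero {f : ℝ → ℝ} (hf : IsAbsCont f) (hi : Integrable f)
    (hd : Integrable (deriv f)) : ∫ x, deriv f x = 0 := by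
  have htop : Filter.Tendsto f Filter.atTop (nhds (f 0 + ∫ x in Ioi 0, deriv f x)) := by
    refine ((intervalIntegral_tendsto_integral_Ioi 0 hd.integrableOn Filter.tendsto_id).const_add
      (f 0)).congr fun x => ?_
    rw [id, (hf 0 x).integral_deriv_eq_sub, add_sub_cancel]
  have hbot : Filter.Tendsto f Filter.atBot (nhds (f 0 - ∫ x in Iic 0, deriv f x)) := by
    refine ((intervalIntegral_tendsto_integral_Iic 0 hd.integrableOn Filter.tendsto_id).const_sub
      (f 0)).congr fun x => ?_
    rw [id, (hf x 0).integral_deriv_eq_sub, sub_sub_cancel]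
  have h1 := (hi.integrableAtFilter Filter.atTop).eq_zero_of_tendsto (fun s hs => by
    obtain ⟨b, hb⟩ := Filter.mem_atTop_sets.1 hs
    exact top_unique (Real.volume_Ici (a := b) ▸ measure_mono fun x hx => hb x hx)) htop
  have h2 := (hi.integrableAtFilter Filter.atBot).eq_zero_of_tendsto (fun s hs => by
    obtain ⟨b, hb⟩ := Filter.mem_atBot_sets.1 hs
    exact top_unique (Real.volume_Iic (a := b) ▸ measure_mono fun x hx => hb x hx)) hbot
  rw [← integral_add_compl measurableSet_Iic hd, compl_Iic]
  linarith

/-! ### Moments of a density, and the standard normal case -/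

namespace HasRealDensity

variable {Ω : Type*} [MeasurableSpace Ω] {P : Measure Ω} {X : Ω → ℝ} {p : ℝ → ℝ}

theorem integrable_mul_iff (hp : HasRealDensity P X p) (hm : Measurable p) {f : ℝ → ℝ}
    (hf : Measurable f) : Integrable (fun x => f x * p x) ↔ Integrable (fun ω => f (X ω)) P := by
  rw [← Function.comp_def f X, ← integrable_map_measure hf.aestronglyMeasurable hp.1.aemeasurable,
    hp.2.2, integrable_withDensity_iff hm.ennreal_ofReal (by simp)]
  simp only [ENNReal.toReal_ofReal (hp.2.1 _)]

theorem integral_mul (hp : HasRealDensity P X p) (hm : Measurable p) {f : ℝ → ℝ}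
    (hf : Measurable f) : ∫ x, f x * p x = ∫ ω, f (X ω) ∂P := by
  rw [← integral_map hp.1.aemeasurable hf.aestronglyMeasurable, hp.2.2,
    integral_withDensity_eq_integral_toReal_smul hm.ennreal_ofReal (by simp)]
  simp only [ENNReal.toReal_ofReal (hp.2.1 _), smul_eq_mul, mul_comm]

theorem integral_sq_mul (hp : HasRealDensity P X p) (hm : Measurable p) (hmean : P[X] = 0)
    (hvar : Var[X; P] = 1) : ∫ x, x ^ 2 * p x = 1 := by
  rw [hp.integral_mul hm (f := fun x => x ^ 2) (by fun_prop),
    ← variance_of_integral_eq_zero hp.1.aemeasurable hmean, hvar]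

variable [IsProbabilityMeasure P]

theorem integrable (hp : HasRealDensity P X p) (hm : Measurable p) : Integrable p := by
  simpa using (hp.integrable_mul_iff hm (f := fun _ => 1) measurable_const).2 (by simp)

theorem integral_eq_one (hp : HasRealDensity P X p) (hm : Measurable p) : ∫ x, p x = 1 := by
  simpa using hp.integral_mul hm (f := fun _ => 1) measurable_const

theorem memLp_two (hp : HasRealDensity P X p) (hvar : Var[X; P] = 1) : MemLp X 2 P :=
  memLp_two_of_variance_ne_zero hp.1.aestronglyMeasurable (by simp [hvar])

theorem integrable_id_mul (hp : HasRealDensity P X p) (hm : Measurable p)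
    (hvar : Var[X; P] = 1) : Integrable fun x => x * p x :=
  (hp.integrable_mul_iff hm measurable_id).2 ((hp.memLp_two hvar).integrable one_le_two)

theorem integrable_sq_mul (hp : HasRealDensity P X p) (hm : Measurable p)
    (hvar : Var[X; P] = 1) : Integrable fun x => x ^ 2 * p x :=
  (hp.integrable_mul_iff hm (measurable_id.pow_const 2)).2 (hp.memLp_two hvar).integrable_sq

end HasRealDensity

theorem stdNormalDensity_eq (x : ℝ) :
    stdNormalDensity x = (√(2 * Real.pi))⁻¹ * Real.exp (-x ^ 2 / 2) := by
  simp [stdNormalDensity, gaussianPDFReal]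

theorem stdNormalDensity_pos (x : ℝ) : 0 < stdNormalDensity x :=
  gaussianPDFReal_pos _ _ _ one_ne_zero

theorem measurable_stdNormalDensity : Measurable stdNormalDensity :=
  measurable_gaussianPDFReal 0 1

theorem hasDerivAt_stdNormalDensity (x : ℝ) :
    HasDerivAt stdNormalDensity (-x * stdNormalDensity x) x := by
  have h : HasDerivAt (fun x : ℝ => -x ^ 2 / 2) (-x) x := by
    have := ((hasDerivAt_id x).pow 2).neg.div_const 2
    convert! this using 1
    simp
    ring
  rw [funext stdNormalDensity_eq]
  convert! h.exp.const_mul (√(2 * Real.pi))⁻¹ using 1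
  ring

theorem isAbsCont_stdNormalDensity : IsAbsCont stdNormalDensity := by
  refine ContDiff.isAbsCont ?_
  rw [funext stdNormalDensity_eq]
  fun_prop

theorem hasRealDensity_stdNormalDensity :
    HasRealDensity (gaussianReal 0 1) id stdNormalDensity := by
  refine ⟨measurable_id, fun x => (stdNormalDensity_pos x).le, ?_⟩
  rw [Measure.map_id, gaussianReal_of_var_ne_zero _ one_ne_zero]
  rfl

theorem fisherInfo_stdNormalDensity : fisherInfo stdNormalDensity = 1 := by
  have hs : {x | 0 < stdNormalDensity x} = univ := eq_univ_of_forall stdNormalDensity_pos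
  have hv : Var[id; gaussianReal 0 1] = 1 := by simp
  have hm : (gaussianReal 0 1)[id] = 0 := by simp
  rw [fisherInfo, if_pos isAbsCont_stdNormalDensity, hs, setLIntegral_univ,
    ← ENNReal.ofReal_one, ← hasRealDensity_stdNormalDensity.integral_sq_mul
      measurable_stdNormalDensity hm hv, ofReal_integral_eq_lintegral_ofReal
      (hasRealDensity_stdNormalDensity.integrable_sq_mul measurable_stdNormalDensity hv)
      (Filter.Eventually.of_forall fun x => mul_nonneg (sq_nonneg x) (stdNormalDensity_pos x).le)]
  refine lintegral_congr fun x => ?_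
  rw [(hasDerivAt_stdNormalDensity x).deriv]
  have := (stdNormalDensity_pos x).ne'
  congr 1
  field_simp

/-! ### Fisher information and the `L¹` norm of `p' + x p` -/

theorem isAbsCont_of_fisherInfo_lt_top {p : ℝ → ℝ} (hI : fisherInfo p < ∞) : IsAbsCont p := by
  by_contra h
  rw [fisherInfo, if_neg h] at hI
  exact lt_irrefl _ hI

theorem fisherInfo_eq_lintegral {p : ℝ → ℝ} (hac : IsAbsCont p) (h0 : ∀ x, 0 ≤ p x) :
    fisherInfo p = ∫⁻ x, ENNReal.ofReal (deriv p x ^ 2 / p x) := by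
  rw [fisherInfo, if_pos hac, ← lintegral_indicator
    (measurableSet_lt measurable_const hac.continuous.measurable)]
  refine lintegral_congr fun x => ?_
  rcases (h0 x).eq_or_lt with h | h
  · simp [← h]
  · simp [indicator, h]

/-- A zero of `p` is a minimum. Hence `p'² / p`, read as `0` there, loses nothing. -/
theorem deriv_eq_zero_of_nonneg_of_eq_zero {p : ℝ → ℝ} (h0 : ∀ x, 0 ≤ p x) {x : ℝ}
    (hx : p x = 0) : deriv p x = 0 :=
  IsLocalMin.deriv_eq_zero (Filter.Eventually.of_forall fun y => hx ▸ h0 y)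

theorem deriv_sq_div_mul {p : ℝ → ℝ} (h0 : ∀ x, 0 ≤ p x) (x : ℝ) :
    deriv p x ^ 2 / p x * p x = deriv p x ^ 2 := by
  rcases eq_or_ne (p x) 0 with h | h
  · simp [h, deriv_eq_zero_of_nonneg_of_eq_zero h0 h]
  · field_simp

section Fisher

variable {Ω : Type*} [MeasurableSpace Ω] {P : Measure Ω} [IsProbabilityMeasure P]
  {X : Ω → ℝ} {p : ℝ → ℝ}

theorem integrable_deriv_sq_div (h0 : ∀ x, 0 ≤ p x) (hI : fisherInfo p < ∞) :
    Integrable fun x => deriv p x ^ 2 / p x := by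
  have hac := isAbsCont_of_fisherInfo_lt_top hI
  refine ⟨(((measurable_deriv p).pow_const 2).div
    hac.continuous.measurable).aestronglyMeasurable, ?_⟩
  rw [hasFiniteIntegral_iff_ofReal (Filter.Eventually.of_forall fun x =>
    div_nonneg (sq_nonneg _) (h0 x)), ← fisherInfo_eq_lintegral hac h0]
  exact hI

theorem integral_deriv_sq_div (h0 : ∀ x, 0 ≤ p x) (hI : fisherInfo p < ∞) :
    ∫ x, deriv p x ^ 2 / p x = (fisherInfo p).toReal := by
  have hac := isAbsCont_of_fisherInfo_lt_top hI
  rw [fisherInfo_eq_lintegral hac h0, ← integral_eq_lintegral_of_nonneg_ae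
    (Filter.Eventually.of_forall fun x => div_nonneg (sq_nonneg _) (h0 x))
    (integrable_deriv_sq_div h0 hI).aestronglyMeasurable]

theorem two_mul_abs_le_add {a b c : ℝ} (hb : 0 ≤ b) (hc : 0 ≤ c) (h : a ^ 2 = b * c) :
    2 * |a| ≤ b + c := by
  refine abs_le_of_sq_le_sq' ?_ (by positivity) |>.2
  rw [mul_pow, sq_abs, h]
  nlinarith [sq_nonneg (b - c)]

theorem HasRealDensity.integrable_deriv (hp : HasRealDensity P X p) (hI : fisherInfo p < ∞) :
    Integrable (deriv p) := by
  have hac := isAbsCont_of_fisherInfo_lt_top hI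
  refine ((integrable_deriv_sq_div hp.2.1 hI).add
    (hp.integrable hac.continuous.measurable)).mono'
    (measurable_deriv p).aestronglyMeasurable (Filter.Eventually.of_forall fun x => ?_)
  have := two_mul_abs_le_add (div_nonneg (sq_nonneg _) (hp.2.1 x)) (hp.2.1 x)
    (deriv_sq_div_mul hp.2.1 x).symm
  simp only [Real.norm_eq_abs, Pi.add_apply]
  linarith [abs_nonneg (deriv p x)]

theorem HasRealDensity.integrable_id_mul_deriv (hp : HasRealDensity P X p)
    (hvar : Var[X; P] = 1) (hI : fisherInfo p < ∞) : Integrable fun x => x * deriv p x := by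
  have hac := isAbsCont_of_fisherInfo_lt_top hI
  refine ((integrable_deriv_sq_div hp.2.1 hI).add
    (hp.integrable_sq_mul hac.continuous.measurable hvar)).mono'
    (measurable_id.mul (measurable_deriv p)).aestronglyMeasurable
    (Filter.Eventually.of_forall fun x => ?_)
  have := two_mul_abs_le_add (a := x * deriv p x) (b := deriv p x ^ 2 / p x)
    (div_nonneg (sq_nonneg _) (hp.2.1 x)) (mul_nonneg (sq_nonneg x) (hp.2.1 x))
    (by linear_combination -x ^ 2 * deriv_sq_div_mul hp.2.1 x)
  simp only [Real.norm_eq_abs, Pi.add_apply]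
  linarith [abs_nonneg (x * deriv p x)]

/-- The derivative `p + x p'` of `x p` has integral zero, and `∫ p = 1`. -/
theorem HasRealDensity.integral_id_mul_deriv (hp : HasRealDensity P X p)
    (hvar : Var[X; P] = 1) (hI : fisherInfo p < ∞) : ∫ x, x * deriv p x = -1 := by
  have hac := isAbsCont_of_fisherInfo_lt_top hI
  have hm := hac.continuous.measurable
  have hxp : IsAbsCont fun x => x * p x := fun a b =>
    (contDiff_id.isAbsCont a b).fun_mul (hac a b)
  have hd : deriv (fun x => x * p x) =ᵐ[volume] fun x => p x + x * deriv p x := by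
    filter_upwards [hac.ae_differentiableAt] with x hx
    simpa using ((hasDerivAt_id' x).fun_mul hx.hasDerivAt).deriv
  have h1 := hp.integrable hm
  have h2 := hp.integrable_id_mul_deriv hvar hI
  have := hxp.integral_deriv_eq_zero (hp.integrable_id_mul hm hvar)
    ((integrable_congr hd).2 (h1.add h2))
  rw [integral_congr_ae hd, integral_add h1 h2, hp.integral_eq_one hm] at this
  linarith

/-- The `L¹` norm of `p' + x p` is controlled by the relative Fisher information. -/
theorem HasRealDensity.integral_abs_deriv_add_le (hp : HasRealDensity P X p) (hmean : P[X] = 0)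
    (hvar : Var[X; P] = 1) (hI : fisherInfo p < ∞) :
    ∫ x, |deriv p x + x * p x| ≤ √(relFisherInfo p) := by
  have hm := (isAbsCont_of_fisherInfo_lt_top hI).continuous.measurable
  have h0 := hp.2.1
  have hJ := integrable_deriv_sq_div h0 hI
  have hxd := hp.integrable_id_mul_deriv hvar hI
  have hx2 := hp.integrable_sq_mul hm hvar
  have hpi := hp.integrable hm
  -- This is `(p' + x p)² / p`, expanded into terms with known integrals.
  let Q : ℝ → ℝ := fun x => deriv p x ^ 2 / p x + 2 * (x * deriv p x) + x ^ 2 * p x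
  have hJx : Integrable fun x => deriv p x ^ 2 / p x + 2 * (x * deriv p x) :=
    hJ.add (hxd.const_mul 2)
  have hQi : Integrable Q := hJx.add hx2
  have hQ : ∫ x, Q x = relFisherInfo p := by
    rw [integral_add hJx hx2, integral_add hJ (hxd.const_mul 2),
      integral_const_mul, integral_deriv_sq_div h0 hI, hp.integral_id_mul_deriv hvar hI,
      hp.integral_sq_mul hm hmean hvar, relFisherInfo, fisherInfo_stdNormalDensity,
      ENNReal.toReal_one]
    ring
  have hQp : ∀ x, (deriv p x + x * p x) ^ 2 = Q x * p x := fun x => by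
    have := deriv_sq_div_mul h0 x
    simp only [Q, add_mul, this]
    ring
  have hQ0 : ∀ x, 0 ≤ Q x := fun x => by
    rcases (h0 x).eq_or_lt with h | h
    · simp [Q, ← h, deriv_eq_zero_of_nonneg_of_eq_zero h0 h.symm]
    · exact nonneg_of_mul_nonneg_left ((sq_nonneg _).trans_eq (hQp x)) h
  set R := ∫ x, |deriv p x + x * p x| with hR
  have hri : Integrable fun x => |deriv p x + x * p x| :=
    ((hp.integrable_deriv hI).add (hp.integrable_id_mul hm hvar)).abs
  have hR0 : 0 ≤ R := integral_nonneg fun x => abs_nonneg _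
  -- Cauchy–Schwarz by integrating `2 R |r| ≤ Q + R² p`, which follows from `r² = Q p`.
  have key : 2 * R * R ≤ relFisherInfo p + R ^ 2 := by
    calc 2 * R * R = ∫ x, 2 * R * |deriv p x + x * p x| := by rw [integral_const_mul]
      _ ≤ ∫ x, (Q x + R ^ 2 * p x) := by
          refine integral_mono (hri.const_mul _) (hQi.add (hpi.const_mul _)) fun x => ?_
          have := two_mul_abs_le_add (a := R * (deriv p x + x * p x)) (hQ0 x)
            (mul_nonneg (sq_nonneg R) (h0 x)) (by rw [mul_pow, hQp]; ring)
          rwa [abs_mul, abs_of_nonneg hR0, ← mul_assoc] at this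
      _ = relFisherInfo p + R ^ 2 := by
          rw [integral_add hQi (hpi.const_mul _), integral_const_mul, hQ, hp.integral_eq_one hm,
            mul_one]
  exact Real.le_sqrt_of_sq_le (by nlinarith)

end Fisher

theorem proposition2p4 {Ω : Type*} [MeasurableSpace Ω] (P : Measure Ω) [IsProbabilityMeasure P]
    (X : Ω → ℝ) (p : ℝ → ℝ) (hp : HasRealDensity P X p)
    (hmean : P[X] = 0) (hvar : Var[X; P] = 1) (hI : fisherInfo p < ∞) :
    tvNorm (fun x => p x - stdNormalDensity x) ≤ ENNReal.ofReal (4 * √(relFisherInfo p)) := by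
  have hac := isAbsCont_of_fisherInfo_lt_top hI
  have hm := hac.continuous.measurable
  have hφ := hasRealDensity_stdNormalDensity
  have hφm := measurable_stdNormalDensity
  have hu : IsAbsCont fun x => p x - stdNormalDensity x := fun a b =>
    (hac a b).fun_sub (isAbsCont_stdNormalDensity a b)
  have h0 : ∫ x, (p x - stdNormalDensity x) = 0 := by
    rw [integral_sub (hp.integrable hm) (hφ.integrable hφm), hp.integral_eq_one hm,
      hφ.integral_eq_one hφm, sub_self]
  have hr : (fun x => ‖deriv (fun x => p x - stdNormalDensity x) x +
      x * (p x - stdNormalDensity x)‖ₑ) =ᵐ[volume] fun x => ENNReal.ofReal |deriv p x + x * p x| := by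
    filter_upwards [hac.ae_differentiableAt] with x hx
    rw [(hx.hasDerivAt.fun_sub (hasDerivAt_stdNormalDensity x)).deriv, ← Real.enorm_eq_ofReal_abs]
    congr 1
    ring
  have hri : Integrable fun x => |deriv p x + x * p x| :=
    ((hp.integrable_deriv hI).add (hp.integrable_id_mul hm hvar)).abs
  refine (hu.eVariationOn_le_four_mul ((hp.integrable hm).sub (hφ.integrable hφm)) h0).trans ?_
  rw [lintegral_congr_ae hr, ← ofReal_integral_eq_lintegral_ofReal hri
    (Filter.Eventually.of_forall fun x => abs_nonneg _),
    ENNReal.ofReal_mul (by norm_num), ENNReal.ofReal_ofNat]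
  gcongr
  exact hp.integral_abs_deriv_add_le hmean hvar hI
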